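/- Let $n\ge 1$, $r\ge 1$ and $k\ge 0$ be integers with $2k\neq n$. Manifolds are smooth, Hausdorff, second countable and without boundary, and tensor products are over $\mathbb{R}$. Let $D$ be a formally self-adjoint, conformally covariant, polydifferential operator of rank $r$ and homogeneity $-2k$ on $n$-manifolds; that is, $D$ assigns to each Riemannian $n$-manifold $(M,g)$ a linear operator $D^g\colon C^\infty(M)^{\otimes(r-1)}\to C^\infty(M)$ such that 1. $D^g(u_1\otimes\dotsm\otimes u_{r-1})$ is a linear combination, with coefficients independent of $(M,g)$, of complete contractions (using the inverse metric) of tensors $\nabla^{N_1}\mathrm{Rm}\otimes\dotsm\otimes\nabla^{N_q}\mathrm{Rm}\otimes\nabla^{K_1}u_1\otimes\dotsm\otimes\nabla^{K_{r-1}}u_{r-1}$; 2. the Dirichlet form $\mathfrak{D}^g(u_1\otimes\dotsm\otimes u_r):=\int_M u_1\,D^g(u_2\otimes\dotsm\otimes u_r)\,\mathrm{dvol}_g$ is symmetric on compactly supported smooth functions; 3. there is a $w\in\mathbb{R}$ such that $\mathfrak{D}^{\widehat g}(e^{w\Upsilon}u_1\otimes\dotsm\otimes e^{w\Upsilon}u_r)=\mathfrak{D}^g(u_1\otimes\dotsm\otimes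 u_r)$ for all compactly supported smooth $u_1,\dotsc,u_r$ whenever $\widehat g=e^{2\Upsilon}g$ with $\Upsilon\in C^\infty(M)$; 4. $D^{c^2g}=c^{-2k}D^g$ for all $(M,g)$ and all constants $c>0$. Let $(M,g)$ be a compact Riemannian $n$-manifold, put $r^\ast:=\frac{rn}{n-2k}$ and, for $u\in C^\infty(M)$, $$\mathcal{F}^g(u):=\frac{\mathfrak{D}^g(u^{\otimes r})}{\|u\|_{r^\ast}^{r}},\qquad \|u\|_{r^\ast}:=\Bigl(\int_M|u|^{r^\ast}\,\mathrm{dvol}_g\Bigr)^{1/r^\ast}.$$ Let $u\in C^\infty(M)$, $u\neq 0$; if $2k>n$, or if $r=1$ and $k=0$ (equivalently, if $r^\ast\le 1$), suppose in addition that $u$ has no zeros. Then $u$ is a critical point of $\mathcal{F}^g$ (that is, for every $v\in C^\infty(M)$ the derivative $\frac{d}{dt}\big|_{t=0}\mathcal{F}^g(u+tv)$ exists and equals $0$) if and only if there is a $\lambda\in\mathbb{R}$ such that $$D^g\bigl(u^{\otimes(r-1)}\bigr)=\Bigl(\frac{n-2k}{r}\Bigr)^{r-1}\lambda\,|u|^{\frac{(r-2)n+4k}{n-2k}}\,u\quad\text{on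 }M,$$ where the exponent equals $r^\ast-2$ and the product $|u|^{r^\ast-2}u$ is read as $0$ where $u=0$. -/

import Mathlib

open scoped Manifold ContDiff

universe u

noncomputable section

namespace PolydiffYamabe

/-- The model space `ℝⁿ` (with its Euclidean norm and Lebesgue measure). -/
abbrev E (n : ℕ) : Type := EuclideanSpace ℝ (Fin n)

/-- Smooth real-valued functions on an `n`-manifold. -/
abbrev Smooth (n : ℕ) (M : Type*) [TopologicalSpace M] [ChartedSpace (E n) M] : Type _ :=
  C^∞⟮𝓡 n, M; ℝ⟯

/-- Smooth Riemannian metrics on an `n`-manifold. -/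
abbrev Metric (n : ℕ) (M : Type*) [TopologicalSpace M] [ChartedSpace (E n) M]
    [IsManifold (𝓡 n) ∞ M] : Type _ :=
  Bundle.ContMDiffRiemannianMetric (𝓡 n) ∞ (E n) (fun x : M => TangentSpace (𝓡 n) x)

/-! ## Tensor calculus in coordinates

Everything below is computed in an open subset of `ℝⁿ` on which the metric has the component
matrix `G`. -/

/-- The partial derivative `∂ᵢ f`. -/
def pd {n : ℕ} (i : Fin n) (f : E n → ℝ) (y : E n) : ℝ :=
  fderiv ℝ f y (EuclideanSpace.single i 1)

/-- The Christoffel symbol `Γˡᵢⱼ = ½ gˡᵐ (∂ᵢ gⱼₘ + ∂ⱼ gᵢₘ - ∂ₘ gᵢⱼ)`. -/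
def christoffel {n : ℕ} (G : E n → Matrix (Fin n) (Fin n) ℝ) (l i j : Fin n) (y : E n) : ℝ :=
  (1 / 2 : ℝ) * ∑ m, (G y)⁻¹ l m *
    (pd i (fun z => G z j m) y + pd j (fun z => G z i m) y - pd m (fun z => G z i j) y)

/-- The components of a covariant tensor field of order `m`. -/
abbrev CoordTensor (n m : ℕ) : Type := (Fin m → Fin n) → E n → ℝ

/-- The Riemann curvature tensor with all indices lowered,
`Rᵢⱼₖₗ = gₗₘ (∂ᵢ Γᵐⱼₖ - ∂ⱼ Γᵐᵢₖ + Γᵐᵢₚ Γᵖⱼₖ - Γᵐⱼₚ Γᵖᵢₖ) = ⟨R(∂ᵢ, ∂ⱼ)∂ₖ, ∂ₗ⟩`. -/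
def riemann {n : ℕ} (G : E n → Matrix (Fin n) (Fin n) ℝ) : CoordTensor n 4 := fun a y =>
  ∑ m, G y (a 3) m *
    (pd (a 0) (christoffel G m (a 1) (a 2)) y - pd (a 1) (christoffel G m (a 0) (a 2)) y
      + ∑ p, (christoffel G m (a 0) p y * christoffel G p (a 1) (a 2) y
        - christoffel G m (a 1) p y * christoffel G p (a 0) (a 2) y))

/-- The Levi-Civita covariant derivative of a covariant tensor field; the new index comes first:
`(∇T)_{j a₁ … aₘ} = ∂ⱼ T_{a₁ … aₘ} - ∑ₛ Γˡ_{j aₛ} T_{a₁ … l … aₘ}`. -/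
def covDeriv {n m : ℕ} (G : E n → Matrix (Fin n) (Fin n) ℝ) (T : CoordTensor n m) :
    CoordTensor n (m + 1) := fun a y =>
  pd (a 0) (T (Fin.tail a)) y
    - ∑ s : Fin m, ∑ l, christoffel G l (a 0) (a s.succ) y *
        T (Function.update (Fin.tail a) s l) y

/-- The iterated covariant derivative `∇ᴺ T`. -/
def iterCovDeriv {n m : ℕ} (G : E n → Matrix (Fin n) (Fin n) ℝ) (T : CoordTensor n m) :
    (N : ℕ) → CoordTensor n (m + N)
  | 0 => T
  | N + 1 => covDeriv G (iterCovDeriv G T N)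

/-- A complete contraction of a tensor product
`∇^{N₁} Rm ⊗ ⋯ ⊗ ∇^{N_q} Rm ⊗ ∇^{K₁} u₁ ⊗ ⋯ ⊗ ∇^{K_ℓ} u_ℓ`:
the numbers of derivatives, and a pairing of all the indices of the tensor product. -/
structure Contraction (ℓ : ℕ) where
  /-- The number of curvature factors. -/
  q : ℕ
  /-- The number of derivatives on each curvature factor. -/
  N : Fin q → ℕ
  /-- The number of derivatives on each function. -/
  K : Fin ℓ → ℕ
  /-- The number of contracted pairs. -/
  p : ℕ
  /-- The two indices in each contracted pair; every index is used exactly once. -/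
  pairing : Fin p ⊕ Fin p ≃ (Σ a : Fin q, Fin (4 + N a)) ⊕ (Σ j : Fin ℓ, Fin (0 + K j))

/-- The value at the point `y` of a complete contraction, where `f j` is the coordinate
expression of the function `u_j` : one sums over all values of all indices the product of the
inverse metric components for the contracted pairs with the components of all the factors. -/
def Contraction.eval {n ℓ : ℕ} (C : Contraction ℓ) (G : E n → Matrix (Fin n) (Fin n) ℝ)
    (f : Fin ℓ → E n → ℝ) (y : E n) : ℝ :=
  ∑ I : (Σ a : Fin C.q, Fin (4 + C.N a)) ⊕ (Σ j : Fin ℓ, Fin (0 + C.K j)) → Fin n,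
    (∏ s : Fin C.p, (G y)⁻¹ (I (C.pairing (Sum.inl s))) (I (C.pairing (Sum.inr s)))) *
    (∏ a : Fin C.q, iterCovDeriv G (riemann G) (C.N a) (fun i => I (Sum.inl ⟨a, i⟩)) y) *
    (∏ j : Fin ℓ, iterCovDeriv (m := 0) G (fun _ => f j) (C.K j) (fun i => I (Sum.inr ⟨j, i⟩)) y)

section manifold

variable {n : ℕ} {M : Type*} [TopologicalSpace M] [ChartedSpace (E n) M]
  [IsManifold (𝓡 n) ∞ M]

/-- The components `gᵢⱼ = g(∂ᵢ, ∂ⱼ)` of the metric in the coordinates `φ`, as functions on the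
coordinate domain. -/
def gram (g : Metric n M) (φ : OpenPartialHomeomorph M (E n)) (y : E n) :
    Matrix (Fin n) (Fin n) ℝ :=
  Matrix.of fun i j => g.inner (φ.symm y)
    (mfderiv (𝓡 n) (𝓡 n) φ.symm y (EuclideanSpace.single i (1 : ℝ) : E n))
    (mfderiv (𝓡 n) (𝓡 n) φ.symm y (EuclideanSpace.single j (1 : ℝ) : E n))

/-- `ĝ = e^{2Υ} g`. -/
def IsConformalChange (g g' : Metric n M) (Υ : Smooth n M) : Prop :=
  ∀ (x : M) (v w : TangentSpace (𝓡 n) x),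
    g'.inner x v w = Real.exp (2 * Υ x) * g.inner x v w

/-- The smooth function `e^{wΥ}`. -/
def expWeight (w : ℝ) (Υ : Smooth n M) : Smooth n M :=
  ⟨fun x => Real.exp (w * Υ x),
    Real.contDiff_exp.contMDiff.comp (contMDiff_const.mul Υ.contMDiff)⟩

variable [MeasurableSpace M] [BorelSpace M]

/-- The measure `√(det gᵢⱼ) dy¹ ⋯ dyⁿ` on the domain of the chart `φ`. -/
def chartVolume (g : Metric n M) (φ : OpenPartialHomeomorph M (E n)) :
    MeasureTheory.Measure M :=
  ((MeasureTheory.volume.restrict φ.target).withDensity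
    (fun y => ENNReal.ofReal (Real.sqrt (gram g φ y).det))).map φ.symm

variable [T2Space M] [SigmaCompactSpace M]

/-- The Riemannian volume measure: the coordinate measures `√(det gᵢⱼ) dy¹ ⋯ dyⁿ` glued by a
smooth partition of unity subordinate to an atlas. -/
def riemVolume (g : Metric n M) : MeasureTheory.Measure M :=
  MeasureTheory.Measure.sum fun i : M =>
    (chartVolume g (chartAt (E n) i)).withDensity fun x => ENNReal.ofReal
      ((SmoothPartitionOfUnity.exists_isSubordinate_chartAt_source (𝓡 n) M).choose i x)

/-- `‖u‖_p = (∫ |u|^p dvol_g)^{1/p}`. -/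
def pNorm (g : Metric n M) (p : ℝ) (u : Smooth n M) : ℝ :=
  (∫ x, |u x| ^ p ∂(riemVolume g)) ^ (1 / p)

end manifold

/-- A natural polydifferential operator of rank `ℓ + 1` on `n`-manifolds: it assigns to each
Riemannian `n`-manifold `(M, g)` a linear operator `D^g : C^∞(M)^{⊗ℓ} → C^∞(M)` (given as a
multilinear map) which is expressed by a universal linear combination of complete contractions.
Manifolds are Hausdorff, `σ`-compact (equivalently, second countable) and without boundary. -/
structure PolydiffOp (n ℓ : ℕ) where
  /-- The operator `D^g`. -/
  toFun : ∀ (M : Type u) [TopologicalSpace M] [ChartedSpace (E n) M] [IsManifold (𝓡 n) ∞ M]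
    [T2Space M] [SigmaCompactSpace M] (_ : Metric n M),
    MultilinearMap ℝ (fun _ : Fin ℓ => Smooth n M) (Smooth n M)
  /-- In all local coordinates, `D^g` is given by the same combination of contractions. -/
  natural : ∃ (m : ℕ) (c : Fin m → ℝ) (C : Fin m → Contraction ℓ),
    ∀ (M : Type u) [TopologicalSpace M] [ChartedSpace (E n) M] [IsManifold (𝓡 n) ∞ M]
      [T2Space M] [SigmaCompactSpace M] (g : Metric n M) (v : Fin ℓ → Smooth n M),
      ∀ φ ∈ IsManifold.maximalAtlas (𝓡 n) ∞ M, ∀ x ∈ φ.source,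
        toFun M g v x =
          ∑ i, c i * (C i).eval (gram g φ) (fun j y => v j (φ.symm y)) (φ x)

namespace PolydiffOp

variable {n ℓ : ℕ} (D : PolydiffOp.{u} n ℓ)

/-- The operator `D^g`. -/
def op {M : Type u} [TopologicalSpace M] [ChartedSpace (E n) M] [IsManifold (𝓡 n) ∞ M]
    [T2Space M] [SigmaCompactSpace M] (g : Metric n M) :
    MultilinearMap ℝ (fun _ : Fin ℓ => Smooth n M) (Smooth n M) :=
  D.toFun M g

/-- The Dirichlet form
`𝔇^g(u₀ ⊗ u₁ ⊗ ⋯ ⊗ u_ℓ) = ∫ u₀ D^g(u₁ ⊗ ⋯ ⊗ u_ℓ) dvol_g`. -/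
def dirichletForm {M : Type u} [TopologicalSpace M] [ChartedSpace (E n) M]
    [IsManifold (𝓡 n) ∞ M] [T2Space M] [SigmaCompactSpace M] [MeasurableSpace M] [BorelSpace M]
    (g : Metric n M) (v : Fin (ℓ + 1) → Smooth n M) : ℝ :=
  ∫ x, v 0 x * D.op g (fun i => v i.succ) x ∂(riemVolume g)

/-- `D` is formally self-adjoint: its Dirichlet form is symmetric on compactly supported
functions. -/
def IsFormallySelfAdjoint : Prop :=
  ∀ (M : Type u) [TopologicalSpace M] [ChartedSpace (E n) M] [IsManifold (𝓡 n) ∞ M]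
    [T2Space M] [SigmaCompactSpace M] [MeasurableSpace M] [BorelSpace M]
    (g : Metric n M) (v : Fin (ℓ + 1) → Smooth n M), (∀ i, HasCompactSupport (v i)) →
    ∀ σ : Equiv.Perm (Fin (ℓ + 1)),
      D.dirichletForm g (fun i => v (σ i)) = D.dirichletForm g v

/-- `D` is conformally covariant: there is a weight `w` with
`𝔇^ĝ(e^{wΥ}u₀ ⊗ ⋯ ⊗ e^{wΥ}u_ℓ) = 𝔇^g(u₀ ⊗ ⋯ ⊗ u_ℓ)` whenever `ĝ = e^{2Υ}g`. -/
def IsConformallyCovariant : Prop :=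
  ∃ w : ℝ, ∀ (M : Type u) [TopologicalSpace M] [ChartedSpace (E n) M] [IsManifold (𝓡 n) ∞ M]
    [T2Space M] [SigmaCompactSpace M] [MeasurableSpace M] [BorelSpace M]
    (g g' : Metric n M) (Υ : Smooth n M), IsConformalChange g g' Υ →
    ∀ v : Fin (ℓ + 1) → Smooth n M, (∀ i, HasCompactSupport (v i)) →
      D.dirichletForm g' (fun i => expWeight w Υ * v i) = D.dirichletForm g v

/-- `D` has homogeneity `h`: `D^{c²g} = c^h D^g` for all constants `c > 0`. -/
def HasHomogeneity (h : ℝ) : Prop :=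
  ∀ (M : Type u) [TopologicalSpace M] [ChartedSpace (E n) M] [IsManifold (𝓡 n) ∞ M]
    [T2Space M] [SigmaCompactSpace M] (g g' : Metric n M) (c : ℝ), 0 < c →
    (∀ (x : M) (v w : TangentSpace (𝓡 n) x), g'.inner x v w = c ^ 2 * g.inner x v w) →
    D.op g' = c ^ h • D.op g

/-- The functional `𝓕^g(u) = 𝔇^g(u^{⊗r}) / ‖u‖_{r*}^r`, where `r = ℓ + 1` is the rank and
`r* = rn / (n - 2k)`. -/
def yamabeFunctional (k : ℕ) {M : Type u} [TopologicalSpace M] [ChartedSpace (E n) M]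
    [IsManifold (𝓡 n) ∞ M] [T2Space M] [SigmaCompactSpace M] [MeasurableSpace M] [BorelSpace M]
    (g : Metric n M) (v : Smooth n M) : ℝ :=
  D.dirichletForm g (fun _ => v) /
    pNorm g (((ℓ + 1 : ℕ) : ℝ) * n / ((n : ℝ) - 2 * k)) v ^ (ℓ + 1)

end PolydiffOp

/-- `v` is a critical point of `F` : all directional derivatives of `F` at `v` exist and are
zero. -/
def IsCriticalPoint {n : ℕ} {M : Type*} [TopologicalSpace M] [ChartedSpace (E n) M]
    (F : Smooth n M → ℝ) (v : Smooth n M) : Prop :=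
  ∀ η : Smooth n M, HasDerivAt (fun t : ℝ => F (v + t • η)) 0 0

end PolydiffYamabe

end

open MeasureTheory Filter Set Bundle
open scoped Topology

/-! Write `p` for `r*`, `Z` for `∫ |u|^p` and `w` for `|u|^{p-2} u`. The result is an Euler–Lagrange
computation. By symmetry of the Dirichlet form all `r` slots contribute equally, so the numerator
has derivative `r ∫ η D(u^{r-1})` in the direction `η` (`hasDerivAt_dirichletForm`). The denominator
is `Z^{r/p}`, whose derivative is `r Z^{r/p-1} ∫ η w` (`hasDerivAt_integral_abs_rpow`). The quotient
rule gives a nonzero multiple of `∫ η (D(u^{r-1}) - c w)` with `c = 𝔇(u^{⊗r}) / Z`.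

Hence `u` is critical iff `D(u^{r-1}) - c w` is orthogonal to every smooth `η`, which forces this
continuous function to vanish (`eq_zero_of_integral_smooth_mul_eq_zero`). Conversely, if
`D(u^{r-1})` is any constant multiple of `w`, pairing with `u` and using `∫ u w = Z` shows that the
constant is `c`.

Differentiating `|u|^p` needs `p > 1` or `u` without zeros. The measure theory needs the glued
volume measure to be finite and to charge nonempty open sets. -/

/-! ### Calculus: multilinear forms along lines and integrals of powers -/

/-- A multilinear form is differentiable along lines, with the expected derivative. -/
theorem MultilinearMap.hasDerivAt_line {V : Type*} [AddCommGroup V] [Module ℝ V] (x y : V) :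
    ∀ {m : ℕ} (f : MultilinearMap ℝ (fun _ : Fin m => V) ℝ),
      HasDerivAt (fun t : ℝ => f fun _ => x + t • y)
        (∑ i, f (Function.update (fun _ => x) i y)) 0
  | 0, f => by
    have : (fun t : ℝ => f fun _ => x + t • y) = fun _ => f fun _ => x := by
      ext t
      exact congrArg f (Subsingleton.elim _ _)
    simpa [this] using hasDerivAt_const (0 : ℝ) (f fun _ => x)
  | m + 1, f => by
    -- Expanding only the first slot leaves two forms in one variable fewer, for the induction.
    have hsplit : (fun t : ℝ => f fun _ => x + t • y) = fun t : ℝ =>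
        (f.curryLeft x) (fun _ => x + t • y) + t * (f.curryLeft y) (fun _ => x + t • y) := by
      ext t
      have : (fun _ : Fin (m + 1) => x + t • y) = Fin.cons (x + t • y) (fun _ => x + t • y) := by
        ext i; refine Fin.cases ?_ (fun _ => ?_) i <;> simp
      rw [this, ← MultilinearMap.curryLeft_apply]
      simp
    rw [hsplit]
    convert! (hasDerivAt_line x y (f.curryLeft x)).add
      ((hasDerivAt_id (0 : ℝ)).mul (hasDerivAt_line x y (f.curryLeft y))) using 1
    have h0 : Function.update (fun _ : Fin (m + 1) => x) 0 y = Fin.cons y (fun _ => x) := by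
      ext i; refine Fin.cases ?_ (fun _ => ?_) i <;> simp
    have hs : ∀ i : Fin m, Function.update (fun _ : Fin (m + 1) => x) i.succ y =
        Fin.cons x (Function.update (fun _ => x) i y) := by
      intro i
      rw [Fin.cons_update]
      congr 1
      ext j; refine Fin.cases ?_ (fun _ => ?_) j <;> simp
    simp [Fin.sum_univ_succ, h0, hs, add_comm]

/-- Differentiation under the integral sign for a jointly continuous derivative on a compact
space. -/
theorem hasDerivAt_integral_of_continuousOn_compact {X : Type*} [TopologicalSpace X]
    [CompactSpace X] [MeasurableSpace X] [BorelSpace X] {μ : Measure X} [IsFiniteMeasure μ]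
    {F F' : ℝ → X → ℝ} {ε : ℝ} (hε : 0 < ε)
    (hF : ∀ t ∈ Icc (-ε) ε, Continuous (F t))
    (hF' : ContinuousOn (fun q : ℝ × X => F' q.1 q.2) (Icc (-ε) ε ×ˢ univ))
    (hd : ∀ x, ∀ t ∈ Icc (-ε) ε, HasDerivAt (fun s => F s x) (F' t x) t) :
    HasDerivAt (fun t => ∫ x, F t x ∂μ) (∫ x, F' 0 x ∂μ) 0 := by
  have hs : Icc (-ε) ε ∈ 𝓝 (0 : ℝ) := Icc_mem_nhds (by linarith) hε
  have h0 : (0 : ℝ) ∈ Icc (-ε) ε := mem_of_mem_nhds hs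
  obtain ⟨C, hC⟩ := (isCompact_Icc.prod isCompact_univ).exists_bound_of_continuousOn hF'
  have hF'0 : Continuous (F' 0) := by
    rw [← continuousOn_univ]
    exact hF'.comp (f := fun x => ((0 : ℝ), x)) (by fun_prop) fun x _ => ⟨h0, mem_univ _⟩
  refine (hasDerivAt_integral_of_dominated_loc_of_deriv_le (bound := fun _ => C) hs ?_ ?_ ?_ ?_
    (integrable_const C) ?_).2
  · filter_upwards [hs] with t ht using (hF t ht).aestronglyMeasurable
  · exact (hF 0 h0).integrable_of_hasCompactSupport (HasCompactSupport.of_compactSpace _)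
  · exact hF'0.aestronglyMeasurable
  · exact .of_forall fun x t ht => hC (t, x) ⟨ht, mem_univ _⟩
  · exact .of_forall fun x t ht => hd x t ht

/-- The `p`-th power of the absolute value is differentiable away from `0`. -/
theorem hasDerivAt_abs_rpow_of_ne_zero (p : ℝ) {x : ℝ} (hx : x ≠ 0) :
    HasDerivAt (fun s : ℝ => |s| ^ p) (p * (|x| ^ (p - 2) * x)) x := by
  have h := (hasDerivAt_abs hx).rpow_const (p := p) (Or.inl (abs_ne_zero.mpr hx))
  convert! h using 1
  have hsplit : |x| ^ (p - 1) = |x| ^ (p - 2) * |x| := by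
    rw [← Real.rpow_add_one (abs_ne_zero.mpr hx)]; congr 1; ring
  rw [hsplit]
  linear_combination (-(p * |x| ^ (p - 2))) * (abs_mul_sign x)

/-- The function `|s|^{p-2} s` is continuous for `p > 1`. -/
theorem continuous_abs_rpow_mul_self {p : ℝ} (hp : 1 < p) :
    Continuous fun s : ℝ => |s| ^ (p - 2) * s := by
  have h := (contDiff_norm_rpow (E := ℝ) hp).continuous_deriv le_rfl
  -- Up to the factor `p`, the function is the derivative of the `C¹` function `|s|^p`; this settles
  -- continuity at `0` also when `p < 2`.
  have h' : deriv (fun s : ℝ => ‖s‖ ^ p) = fun s => p * (|s| ^ (p - 2) * s) := by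
    ext s
    rw [← mul_assoc]
    exact (hasDerivAt_abs_rpow s hp).deriv
  rw [h'] at h
  have hp0 : p ≠ 0 := by positivity
  simpa [inv_mul_cancel_left₀ hp0] using h.const_mul p⁻¹

/-- The derivative of `∫ |u + t v|^p` at `t = 0` on a compact space. -/
theorem hasDerivAt_integral_abs_rpow {X : Type*} [TopologicalSpace X] [CompactSpace X]
    [MeasurableSpace X] [BorelSpace X] {μ : Measure X} [IsFiniteMeasure μ] {p : ℝ} {u v : X → ℝ}
    (hu : Continuous u) (hv : Continuous v) (hp : 1 < p ∨ ∀ x, u x ≠ 0) :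
    HasDerivAt (fun t : ℝ => ∫ x, |u x + t * v x| ^ p ∂μ)
      (p * ∫ x, v x * (|u x| ^ (p - 2) * u x) ∂μ) 0 := by
  -- `S` is a set on which `|s|^p` is continuously differentiable and which contains all values of
  -- `u + t v` for small `t`: the whole line if `p > 1`, otherwise the complement of `0`.
  obtain ⟨S, hcont, hder, ε, hε, hS⟩ : ∃ S : Set ℝ,
      ContinuousOn (fun s : ℝ => |s| ^ (p - 2) * s) S ∧
      (∀ s ∈ S, HasDerivAt (fun s : ℝ => |s| ^ p) (p * (|s| ^ (p - 2) * s)) s) ∧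
      ∃ ε > 0, ∀ t ∈ Icc (-ε) ε, ∀ x, u x + t * v x ∈ S := by
    rcases hp with hp | hp
    · refine ⟨univ, (continuous_abs_rpow_mul_self hp).continuousOn, fun s _ => ?_, 1, one_pos,
        fun _ _ _ => mem_univ _⟩
      rw [← mul_assoc]
      exact hasDerivAt_abs_rpow s hp
    · refine ⟨{0}ᶜ, ?_, fun s hs => hasDerivAt_abs_rpow_of_ne_zero p hs, ?_⟩
      · exact (continuousOn_id.abs.rpow_const fun s hs => Or.inl (abs_ne_zero.mpr hs)).mul
          continuousOn_id
      -- Compactness of `X` makes the range of admissible `t` uniform in `x`.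
      · have hev : ∀ᶠ t in 𝓝 (0 : ℝ), ∀ x ∈ (univ : Set X), u x + t * v x ≠ 0 := by
          refine isCompact_univ.eventually_forall_of_forall_eventually fun x _ => ?_
          have hc : Continuous fun q : ℝ × X => u q.2 + q.1 * v q.2 := by fun_prop
          exact hc.continuousAt.eventually_ne (by simpa using hp x)
        obtain ⟨ε, hε, h⟩ := Metric.nhds_basis_closedBall.eventually_iff.1 hev
        refine ⟨ε, hε, fun t ht x => h ?_ x (mem_univ x)⟩
        simpa [Real.closedBall_eq_Icc] using ht
  have hcd : ContinuousOn (fun q : ℝ × X => p * (v q.2 * (|u q.2 + q.1 * v q.2| ^ (p - 2) *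
      (u q.2 + q.1 * v q.2)))) (Icc (-ε) ε ×ˢ univ) := by
    refine continuousOn_const.mul ((by fun_prop : Continuous fun q : ℝ × X => v q.2).continuousOn.mul
      (hcont.comp (f := fun q : ℝ × X => u q.2 + q.1 * v q.2) (by fun_prop) ?_))
    exact fun q hq => hS q.1 hq.1 q.2
  have h := hasDerivAt_integral_of_continuousOn_compact (μ := μ)
    (F := fun t x => |u x + t * v x| ^ p)
    (F' := fun t x => p * (v x * (|u x + t * v x| ^ (p - 2) * (u x + t * v x)))) hε ?_ hcd ?_
  · simpa [integral_const_mul] using h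
  · refine fun t ht => continuous_iff_continuousAt.2 fun x => ?_
    exact ((hder _ (hS t ht x)).continuousAt).comp (f := fun x => u x + t * v x)
      (by fun_prop)
  · intro x t ht
    have hl : HasDerivAt (fun s : ℝ => u x + s * v x) (v x) t := by
      simpa using ((hasDerivAt_id t).mul_const (v x)).const_add (u x)
    convert! (hder _ (hS t ht x)).comp t hl using 1
    ring

/-! ### The Riemannian volume measure: finiteness and positivity on open sets -/

namespace PolydiffYamabe

section volume

variable {n : ℕ} {M : Type*} [TopologicalSpace M] [ChartedSpace (E n) M]
  [IsManifold (𝓡 n) ∞ M] (g : Metric n M)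

theorem continuousOn_gram_chartAt (i : M) : ContinuousOn (gram g (chartAt (E n) i))
    (chartAt (E n) i).target := by
  set φ := chartAt (E n) i
  have : IsManifold (𝓡 n) 1 M := IsManifold.of_le (n := ∞) (by simp)
  have hφ : ContMDiffOn (𝓡 n) (𝓡 n) ∞ φ.symm φ.target := contMDiffOn_chart_symm
  have hT := hφ.continuousOn_tangentMapWithin (by simp) φ.open_target.uniqueMDiffOn
  -- The coordinate fields are images of constant sections under the continuous tangent map of
  -- `φ.symm`.
  have hvec : ∀ a : Fin n, ContinuousOn (fun y => TotalSpace.mk' (E n) (E := fun x : M =>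
      TangentSpace (𝓡 n) x) (φ.symm y)
      (mfderiv (𝓡 n) (𝓡 n) φ.symm y (EuclideanSpace.single a (1 : ℝ) : E n))) φ.target := by
    intro a
    have hsec : Continuous fun y : E n => (⟨y, (EuclideanSpace.single a (1 : ℝ) : E n)⟩ :
        TangentBundle (𝓡 n) (E n)) := by
      have h := (tangentBundleModelSpaceHomeomorph (𝓡 n) (H := E n)).symm.continuous.comp
        (f := fun y : E n => ((y, (EuclideanSpace.single a (1 : ℝ) : E n)) : ModelProd (E n) (E n)))
        (Continuous.prodMk continuous_id continuous_const)
      exact h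
    refine (hT.comp hsec.continuousOn fun y hy => hy).congr fun y hy => ?_
    simp only [Function.comp, tangentMapWithin]
    rw [mfderivWithin_of_isOpen φ.open_target hy]
  refine continuousOn_pi.2 fun a => continuousOn_pi.2 fun b => ?_
  have hg : ContinuousOn (fun y => TotalSpace.mk' (E n →L[ℝ] E n →L[ℝ] ℝ)
      (E := fun x : M => TangentSpace (𝓡 n) x →L[ℝ] TangentSpace (𝓡 n) x →L[ℝ] ℝ) (φ.symm y)
      (g.inner (φ.symm y))) φ.target :=
    g.contMDiff.continuous.comp_continuousOn hφ.continuousOn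
  have h := ContinuousOn.clm_bundle_apply₂ (F₃ := ℝ) (E₃ := Bundle.Trivial M ℝ) hg (hvec a) (hvec b)
  intro y hy
  exact ((Bundle.Trivial.homeomorphProd M ℝ).continuous.comp_continuousOn h).snd y hy

/-- The Gram matrix represents the pullback of `g` under the differential of `φ.symm`, which is
injective. -/
theorem gram_chartAt_posDef (i : M) {y : E n} (hy : y ∈ (chartAt (E n) i).target) :
    (gram g (chartAt (E n) i) y).PosDef := by
  set φ := chartAt (E n) i
  have : IsManifold (𝓡 n) 1 M := IsManifold.of_le (n := ∞) (by simp)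
  have hinj : Function.Injective (mfderiv (𝓡 n) (𝓡 n) φ.symm y) :=
    (mdifferentiable_chart i).symm.mfderiv_injective hy
  refine Matrix.PosDef.of_dotProduct_mulVec_pos ?_ fun c hc => ?_
  · ext a b
    exact g.symm _ _ _
  · have hsum : mfderiv (𝓡 n) (𝓡 n) φ.symm y (WithLp.toLp 2 c : E n) =
        ∑ a, c a • mfderiv (𝓡 n) (𝓡 n) φ.symm y (EuclideanSpace.single a (1 : ℝ) : E n) := by
      have : (WithLp.toLp 2 c : E n) = ∑ a, c a • (EuclideanSpace.single a (1 : ℝ) : E n) := by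
        ext b; simp [Finset.sum_apply, Pi.single_apply]
      rw [this]
      exact (map_sum _ _ _).trans (Finset.sum_congr rfl fun a _ => map_smul _ _ _)
    have hne : mfderiv (𝓡 n) (𝓡 n) φ.symm y (WithLp.toLp 2 c : E n) ≠ 0 := by
      intro h
      refine hc ?_
      have := hinj (h.trans (map_zero _).symm)
      exact congrArg WithLp.ofLp this
    have hpos := g.pos _ _ hne
    rw [hsum] at hpos
    simp only [map_sum, sum_apply, map_smul, smul_apply,
      smul_eq_mul] at hpos
    simp only [Finset.mul_sum] at hpos
    rw [Finset.sum_comm] at hpos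
    simpa [gram, dotProduct, Matrix.mulVec, Finset.mul_sum, mul_assoc, mul_comm, mul_left_comm]
      using hpos

theorem aemeasurable_sqrt_det_gram (i : M) :
    AEMeasurable (fun y => ENNReal.ofReal (Real.sqrt (gram g (chartAt (E n) i) y).det))
      (volume.restrict (chartAt (E n) i).target) :=
  ((ENNReal.continuous_ofReal.comp Real.continuous_sqrt).comp_continuousOn
    ((Continuous.matrix_det continuous_id).comp_continuousOn
      (continuousOn_gram_chartAt g i))).aemeasurable (chartAt (E n) i).open_target.measurableSet

variable [MeasurableSpace M] [BorelSpace M]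

theorem aemeasurable_chartAt_symm (i : M) : AEMeasurable (chartAt (E n) i).symm
    ((volume.restrict (chartAt (E n) i).target).withDensity
      (fun y => ENNReal.ofReal (Real.sqrt (gram g (chartAt (E n) i) y).det))) :=
  ((chartAt (E n) i).continuousOn_symm.aemeasurable
    (chartAt (E n) i).open_target.measurableSet).mono_ac (withDensity_absolutelyContinuous _ _)

/-- The chart carries `K` to a compact subset of its target, where the continuous density is bounded
and Lebesgue measure is finite. -/
theorem chartVolume_lt_top_of_isCompact [T2Space M] (i : M) {K : Set M} (hK : IsCompact K)
    (hKs : K ⊆ (chartAt (E n) i).source) : chartVolume g (chartAt (E n) i) K < ⊤ := by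
  have hsymm := aemeasurable_chartAt_symm g i
  have hgram := continuousOn_gram_chartAt g i
  unfold chartVolume
  set φ := chartAt (E n) i
  have hφK : IsCompact (φ '' K) := hK.image_of_continuousOn (φ.continuousOn.mono hKs)
  have hφKt : φ '' K ⊆ φ.target := by
    rintro _ ⟨x, hx, rfl⟩
    exact φ.map_source (hKs hx)
  rw [Measure.map_apply_of_aemeasurable hsymm hK.measurableSet, withDensity_apply',
    Measure.restrict_restrict' φ.open_target.measurableSet]
  have hsub : φ.symm ⁻¹' K ∩ φ.target ⊆ φ '' K := fun y hy => ⟨φ.symm y, hy.1, φ.right_inv hy.2⟩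
  have hcont : ContinuousOn (fun y => Real.sqrt (gram g φ y).det) (φ '' K) :=
    Real.continuous_sqrt.comp_continuousOn
      ((Continuous.matrix_det continuous_id).comp_continuousOn (hgram.mono hφKt))
  obtain ⟨C, hC⟩ := hφK.exists_bound_of_continuousOn hcont
  refine (lintegral_mono_set hsub).trans_lt ?_
  refine (setLIntegral_mono' hφK.measurableSet (g := fun _ => ENNReal.ofReal C) fun y hy =>
    ENNReal.ofReal_le_ofReal ((le_abs_self _).trans (hC y hy))).trans_lt ?_
  rw [setLIntegral_const]
  exact ENNReal.mul_lt_top ENNReal.ofReal_lt_top hφK.measure_lt_top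

/-- The density is strictly positive on the chart target, so a null set would have a Lebesgue-null
preimage there, yet that preimage is open and nonempty. -/
theorem chartVolume_ne_zero_of_isOpen (i : M) {U : Set M} (hU : IsOpen U)
    (hUs : U ⊆ (chartAt (E n) i).source) (hne : U.Nonempty) :
    chartVolume g (chartAt (E n) i) U ≠ 0 := by
  have hsymm := aemeasurable_chartAt_symm g i
  have hdens := aemeasurable_sqrt_det_gram g i
  have hpos := fun y => gram_chartAt_posDef g i (y := y)
  unfold chartVolume
  set φ := chartAt (E n) i
  rw [Measure.map_apply_of_aemeasurable hsymm hU.measurableSet]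
  intro h
  rw [withDensity_apply_eq_zero' hdens, Measure.restrict_apply' φ.open_target.measurableSet] at h
  have hopen : IsOpen (φ.target ∩ φ.symm ⁻¹' U) := φ.symm.isOpen_inter_preimage hU
  obtain ⟨x, hx⟩ := hne
  refine (hopen.measure_pos volume ⟨φ x, φ.map_source (hUs hx), ?_⟩).ne' (measure_mono_null ?_ h)
  · simpa [φ.left_inv (hUs hx)] using hx
  · refine fun y hy => ⟨⟨?_, hy.2⟩, hy.1⟩
    simpa using (hpos y hy.1).det_pos

variable [T2Space M]

/-- Some `ρ i` is positive at a point of `U`, and `U ∩ {ρ i > 0}` is a nonempty open subset of the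
`i`-th chart domain, so the `i`-th summand alone charges `U`. -/
theorem isOpenPosMeasure_riemVolume [SigmaCompactSpace M] :
    (riemVolume g).IsOpenPosMeasure := by
  constructor
  intro U hU ⟨x, hx⟩ h0
  unfold riemVolume at h0
  have hsub := (SmoothPartitionOfUnity.exists_isSubordinate_chartAt_source (𝓡 n) M).choose_spec
  set ρ := (SmoothPartitionOfUnity.exists_isSubordinate_chartAt_source (𝓡 n) M).choose
  obtain ⟨i, hi⟩ := ρ.exists_pos_of_mem (mem_univ x)
  rw [Measure.sum_apply _ hU.measurableSet, ENNReal.tsum_eq_zero] at h0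
  have hρ : Measurable fun x => ENNReal.ofReal (ρ i x) :=
    (ENNReal.continuous_ofReal.comp (ρ i).contMDiff.continuous).measurable
  have h := h0 i
  rw [withDensity_apply_eq_zero' hρ.aemeasurable] at h
  have hset : {x | ENNReal.ofReal (ρ i x) ≠ 0} = {x | 0 < ρ i x} := by
    ext; simp
  rw [hset] at h
  refine chartVolume_ne_zero_of_isOpen g i
    ((isOpen_lt continuous_const (ρ i).contMDiff.continuous).inter hU) ?_ ⟨x, hi, hx⟩ h
  exact fun y hy => hsub i (subset_tsupport _ (ne_of_gt hy.1 : ρ i y ≠ 0))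

/-- By local finiteness and compactness only finitely many `ρ i` are nonzero, and each such summand
is at most the chart volume of the compact set `tsupport (ρ i)`. -/
theorem isFiniteMeasure_riemVolume [CompactSpace M] : IsFiniteMeasure (riemVolume g) := by
  constructor
  unfold riemVolume
  have hsub := (SmoothPartitionOfUnity.exists_isSubordinate_chartAt_source (𝓡 n) M).choose_spec
  set ρ := (SmoothPartitionOfUnity.exists_isSubordinate_chartAt_source (𝓡 n) M).choose
  have hfin := ρ.locallyFinite.finite_nonempty_of_compact
  rw [Measure.sum_apply _ MeasurableSet.univ, tsum_eq_sum (s := hfin.toFinset)]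
  · refine ENNReal.sum_lt_top.2 fun i _ => ?_
    rw [withDensity_apply _ MeasurableSet.univ, setLIntegral_univ]
    calc ∫⁻ x, ENNReal.ofReal (ρ i x) ∂(chartVolume g (chartAt (E n) i))
        ≤ ∫⁻ x, (tsupport (ρ i)).indicator 1 x ∂(chartVolume g (chartAt (E n) i)) := by
          refine lintegral_mono fun x => ?_
          by_cases hx : x ∈ tsupport (ρ i)
          · simpa [hx] using ρ.le_one i x
          · simp [hx, image_eq_zero_of_notMem_tsupport hx]
      _ = chartVolume g (chartAt (E n) i) (tsupport (ρ i)) :=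
          lintegral_indicator_one (isClosed_tsupport _).measurableSet
      _ < ⊤ := chartVolume_lt_top_of_isCompact g i (isClosed_tsupport _).isCompact (hsub i)
  · intro i hi
    have hz : ∀ x, ρ i x = 0 := by
      simpa [Set.Nonempty] using hi
    simp [hz]

end volume

end PolydiffYamabe

/-! ### First variation of the Dirichlet form and of the quotient -/

namespace PolydiffYamabe

theorem pNorm_pow {n : ℕ} {M : Type*} [TopologicalSpace M] [ChartedSpace (E n) M]
    [IsManifold (𝓡 n) ∞ M] [T2Space M] [SigmaCompactSpace M] [MeasurableSpace M]
    (g : Metric n M) (p : ℝ) (m : ℕ) (u : Smooth n M) :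
    pNorm g p u ^ m = (∫ x, |u x| ^ p ∂(riemVolume g)) ^ (m / p) := by
  rw [pNorm, ← Real.rpow_natCast, ← Real.rpow_mul (integral_nonneg fun x => by positivity)]
  congr 1
  ring

variable {n ℓ : ℕ} {M : Type u} [TopologicalSpace M] [ChartedSpace (E n) M]
  [IsManifold (𝓡 n) ∞ M] [T2Space M] [CompactSpace M] [MeasurableSpace M] [BorelSpace M]
  (g : Metric n M)

theorem integrable_riemVolume_of_continuous {f : M → ℝ} (hf : Continuous f) :
    Integrable f (riemVolume g) :=
  have := isFiniteMeasure_riemVolume g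
  hf.integrable_of_hasCompactSupport (HasCompactSupport.of_compactSpace _)

/-- The `L²` pairing of smooth functions. -/
noncomputable def smoothPairing : Smooth n M →ₗ[ℝ] Smooth n M →ₗ[ℝ] ℝ :=
  have hint (f h : Smooth n M) : Integrable (fun x => f x * h x) (riemVolume g) :=
    integrable_riemVolume_of_continuous g (f.contMDiff.continuous.mul h.contMDiff.continuous)
  LinearMap.mk₂ ℝ (fun f h => ∫ x, f x * h x ∂(riemVolume g))
    (fun f f' h => by
      rw [← integral_add (hint f h) (hint f' h)]
      exact integral_congr_ae (.of_forall fun x => add_mul (f x) (f' x) (h x)))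
    (fun c f h => by
      rw [smul_eq_mul, ← integral_const_mul]
      exact integral_congr_ae (.of_forall fun x => mul_assoc c (f x) (h x)))
    (fun f h h' => by
      rw [← integral_add (hint f h) (hint f h')]
      exact integral_congr_ae (.of_forall fun x => mul_add (f x) (h x) (h' x)))
    (fun c f h => by
      rw [smul_eq_mul, ← integral_const_mul]
      exact integral_congr_ae (.of_forall fun x => mul_left_comm (f x) c (h x)))

namespace PolydiffOp

variable (D : PolydiffOp.{u} n ℓ)

/-- The Dirichlet form on a compact manifold, as a multilinear form. -/
noncomputable def dirichletMultilinear : MultilinearMap ℝ (fun _ : Fin (ℓ + 1) => Smooth n M) ℝ :=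
  LinearMap.uncurryLeft
    { toFun f := (smoothPairing g f).compMultilinearMap (D.op g)
      map_add' f f' := by ext; simp
      map_smul' c f := by ext; simp }

theorem dirichletMultilinear_apply (v : Fin (ℓ + 1) → Smooth n M) :
    D.dirichletMultilinear g v = D.dirichletForm g v :=
  rfl

theorem hasDerivAt_dirichletForm (hsa : D.IsFormallySelfAdjoint) (u η : Smooth n M) :
    HasDerivAt (fun t : ℝ => D.dirichletForm g fun _ => u + t • η)
      ((ℓ + 1 : ℝ) * ∫ x, η x * D.op g (fun _ => u) x ∂(riemVolume g)) 0 := by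
  have h := (D.dirichletMultilinear g).hasDerivAt_line u η
  simp only [dirichletMultilinear_apply] at h
  convert! h using 1
  have hi : ∀ i : Fin (ℓ + 1), D.dirichletForm g (Function.update (fun _ => u) i η) =
      ∫ x, η x * D.op g (fun _ => u) x ∂(riemVolume g) := by
    intro i
    -- Symmetry moves `η` from slot `i` to slot `0`, the one not acted on by `D`.
    rw [← hsa M g _ (fun _ => HasCompactSupport.of_compactSpace _) (Equiv.swap 0 i)]
    have : (fun j => Function.update (fun _ : Fin (ℓ + 1) => u) i η (Equiv.swap 0 i j)) =
        Fin.cons η fun _ => u := by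
      ext1 j
      refine Fin.cases ?_ (fun j => ?_) j
      · simp
      · have hne : Equiv.swap 0 i j.succ ≠ i := by
          rw [Ne, Equiv.swap_apply_eq_iff, Equiv.swap_apply_right]
          exact Fin.succ_ne_zero j
        simp [hne]
    rw [this]
    rfl
  simp [hi]

end PolydiffOp

theorem integral_abs_rpow_pos {p : ℝ} {u : Smooth n M} (hu : u ≠ 0)
    (hp : 1 < p ∨ ∀ x, u x ≠ 0) : 0 < ∫ x, |u x| ^ p ∂(riemVolume g) := by
  have := isFiniteMeasure_riemVolume g
  have := isOpenPosMeasure_riemVolume g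
  obtain ⟨x, hx⟩ : ∃ x, u x ≠ 0 := by
    by_contra! h
    exact hu (by ext x; exact h x)
  have hcont : Continuous fun x => |u x| ^ p := by
    rcases hp with hp | hp
    · exact u.contMDiff.continuous.abs.rpow_const fun _ => Or.inr (by linarith)
    · exact u.contMDiff.continuous.abs.rpow_const fun x => Or.inl (abs_ne_zero.mpr (hp x))
  refine hcont.integral_pos_of_hasCompactSupport_nonneg_nonzero
    (HasCompactSupport.of_compactSpace _) (fun x => by positivity) (x := x) ?_
  exact (Real.rpow_pos_of_pos (abs_pos.mpr hx) p).ne'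

/-- A continuous function orthogonal to all smooth functions vanishes. -/
theorem eq_zero_of_integral_smooth_mul_eq_zero {h : M → ℝ} (hh : Continuous h)
    (hz : ∀ η : Smooth n M, ∫ x, η x * h x ∂(riemVolume g) = 0) (x : M) : h x = 0 := by
  have := isFiniteMeasure_riemVolume g
  have := isOpenPosMeasure_riemVolume g
  -- The fundamental lemma of the calculus of variations gives vanishing almost everywhere;
  -- continuity and positivity on open sets upgrade it to everywhere.
  have hae := ae_eq_zero_of_integral_contMDiff_smul_eq_zero (𝓡 n) (μ := riemVolume g)
    (integrable_riemVolume_of_continuous g hh).locallyIntegrable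
    fun η hη _ => hz ⟨η, hη⟩
  exact congrFun (hh.ae_eq_iff_eq (riemVolume g) continuous_const |>.1 hae) x

/-- The derivative of the quotient of the Dirichlet form by the power of the norm. -/
theorem PolydiffOp.hasDerivAt_dirichletForm_div_pNorm_pow (D : PolydiffOp.{u} n ℓ)
    (hsa : D.IsFormallySelfAdjoint) {p : ℝ} (hp0 : p ≠ 0) {u : Smooth n M} (hu : u ≠ 0)
    (hp : 1 < p ∨ ∀ x, u x ≠ 0) (η : Smooth n M) :
    HasDerivAt (fun t : ℝ => D.dirichletForm g (fun _ => u + t • η) /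
        pNorm g p (u + t • η) ^ (ℓ + 1))
      ((ℓ + 1 : ℝ) / (∫ x, |u x| ^ p ∂(riemVolume g)) ^ ((ℓ + 1 : ℝ) / p) *
        (∫ x, η x * D.op g (fun _ => u) x ∂(riemVolume g) -
          D.dirichletForm g (fun _ => u) / (∫ x, |u x| ^ p ∂(riemVolume g)) *
            ∫ x, η x * (|u x| ^ (p - 2) * u x) ∂(riemVolume g))) 0 := by
  have := isFiniteMeasure_riemVolume g
  have hZ := integral_abs_rpow_pos g hu hp
  have hN := D.hasDerivAt_dirichletForm g hsa u η
  have hI := hasDerivAt_integral_abs_rpow (μ := riemVolume g) u.contMDiff.continuous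
    η.contMDiff.continuous hp
  have hP := hI.rpow_const (p := ((ℓ + 1 : ℕ) : ℝ) / p) (Or.inl (by simpa using hZ.ne'))
  have hPe : (fun t : ℝ => (∫ x, |u x + t * η x| ^ p ∂(riemVolume g)) ^ (((ℓ + 1 : ℕ) : ℝ) / p)) =
      fun t : ℝ => pNorm g p (u + t • η) ^ (ℓ + 1) := by
    ext t
    rw [pNorm_pow]
    rfl
  rw [hPe] at hP
  have hQ := hN.div hP (by simpa [pNorm_pow] using (Real.rpow_pos_of_pos hZ _).ne')
  convert! hQ using 1
  simp only [zero_smul, add_zero, zero_mul, pNorm_pow]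
  set Z := ∫ x, |u x| ^ p ∂(riemVolume g)
  have hZr : Z ^ (((ℓ + 1 : ℕ) : ℝ) / p - 1) = Z ^ (((ℓ + 1 : ℕ) : ℝ) / p) / Z :=
    Real.rpow_sub_one hZ.ne' _
  rw [hZr]
  push_cast
  have hZp := (Real.rpow_pos_of_pos hZ ((ℓ + 1 : ℝ) / p)).ne'
  field_simp

end PolydiffYamabe

/-! ### The Euler–Lagrange equation -/

open PolydiffYamabe in
theorem lemma1p2 {n r ℓ k : ℕ} (hn : 0 < n) (hr : r = ℓ + 1) (hnk : 2 * k ≠ n)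
    (D : PolydiffYamabe.PolydiffOp.{u} n ℓ)
    (hsa : D.IsFormallySelfAdjoint) (hcc : D.IsConformallyCovariant)
    (hhom : D.HasHomogeneity (-2 * (k : ℝ)))
    {M : Type u} [TopologicalSpace M] [ChartedSpace (PolydiffYamabe.E n) M]
    [IsManifold (𝓡 n) ∞ M] [T2Space M] [CompactSpace M] [MeasurableSpace M] [BorelSpace M]
    (g : PolydiffYamabe.Metric n M) (v : PolydiffYamabe.Smooth n M) (hv : v ≠ 0)
    (hv' : n < 2 * k ∨ (r = 1 ∧ k = 0) → ∀ x, v x ≠ 0) :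
    PolydiffYamabe.IsCriticalPoint (D.yamabeFunctional k g) v ↔
      ∃ lam : ℝ, ∀ x : M,
        D.op g (fun _ => v) x =
          (((n : ℝ) - 2 * k) / r) ^ ℓ * lam *
            |v x| ^ ((((r : ℝ) - 2) * n + 4 * k) / ((n : ℝ) - 2 * k)) * v x := by
  subst hr
  have hd : (n : ℝ) - 2 * k ≠ 0 := sub_ne_zero.2 (by exact_mod_cast hnk.symm)
  have hn' : (0 : ℝ) < n := by exact_mod_cast hn
  have hr' : (0 : ℝ) < ((ℓ + 1 : ℕ) : ℝ) := by positivity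
  set p : ℝ := ((ℓ + 1 : ℕ) : ℝ) * n / ((n : ℝ) - 2 * k) with hpdef
  have hp0 : p ≠ 0 := div_ne_zero (mul_pos hr' hn').ne' hd
  have hexp : (((ℓ + 1 : ℕ) : ℝ) - 2) * n + 4 * k = (p - 2) * (n - 2 * k) := by
    rw [hpdef]; field_simp; ring
  rw [hexp, mul_div_cancel_right₀ _ hd]
  -- Outside the excluded cases `n - 2k > 0`, and `p > 1` amounts to `ℓ n + 2k > 0`.
  have hp : 1 < p ∨ ∀ x, v x ≠ 0 := by
    by_cases h : n < 2 * k ∨ (ℓ + 1 = 1 ∧ k = 0)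
    · exact Or.inr (hv' h)
    · left
      push Not at h
      have hd' : (0 : ℝ) < (n : ℝ) - 2 * k := by
        have : 2 * k < n := lt_of_le_of_ne h.1 hnk
        rw [sub_pos]; exact_mod_cast this
      rw [hpdef, one_lt_div hd']
      rcases Nat.eq_zero_or_pos ℓ with hℓ | hℓ
      · have hk : (0 : ℝ) < k := by exact_mod_cast Nat.pos_of_ne_zero (h.2 (by omega))
        subst hℓ
        push_cast
        linarith
      · have hℓ' : (0 : ℝ) < ℓ := by exact_mod_cast hℓ
        push_cast
        nlinarith [(Nat.cast_nonneg k : (0 : ℝ) ≤ k), mul_pos hℓ' hn']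
  have hZ := integral_abs_rpow_pos g hv hp
  have hder := D.hasDerivAt_dirichletForm_div_pNorm_pow g hsa hp0 hv hp
  set Z := ∫ x, |v x| ^ p ∂(riemVolume g) with hZdef
  set c := D.dirichletForm g (fun _ => v) / Z with hc
  set w : M → ℝ := fun x => |v x| ^ (p - 2) * v x with hw
  have hwc : Continuous w := by
    rcases hp with hp | hp
    · exact (continuous_abs_rpow_mul_self hp).comp v.contMDiff.continuous
    · exact (v.contMDiff.continuous.abs.rpow_const fun x => Or.inl (abs_ne_zero.mpr (hp x))).mul
        v.contMDiff.continuous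
  have hDc : Continuous fun x => D.op g (fun _ => v) x := (D.op g fun _ => v).contMDiff.continuous
  have hfac : (ℓ + 1 : ℝ) / Z ^ ((ℓ + 1 : ℝ) / p) ≠ 0 :=
    div_ne_zero (by positivity) (Real.rpow_pos_of_pos hZ _).ne'
  have hcoef : (((n : ℝ) - 2 * k) / ((ℓ + 1 : ℕ) : ℝ)) ^ ℓ ≠ 0 :=
    pow_ne_zero _ (div_ne_zero hd hr'.ne')
  have hcrit : IsCriticalPoint (D.yamabeFunctional k g) v ↔
      ∀ η : Smooth n M, ∫ x, η x * D.op g (fun _ => v) x ∂(riemVolume g) =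
        c * ∫ x, η x * w x ∂(riemVolume g) := by
    refine forall_congr' fun η => ⟨fun h => ?_, fun h => ?_⟩
    · exact sub_eq_zero.1 ((mul_eq_zero.1 ((hder η).unique h)).resolve_left hfac)
    · have h' := hder η
      rw [h, sub_self, mul_zero] at h'
      exact h'
  rw [hcrit]
  constructor
  · intro h
    -- The constant is chosen so that the normalizing factor cancels and the multiplier of `w` is
    -- `c`.
    refine ⟨c / (((n : ℝ) - 2 * k) / ((ℓ + 1 : ℕ) : ℝ)) ^ ℓ, fun x => ?_⟩
    rw [mul_div_cancel₀ _ hcoef, mul_assoc]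
    refine sub_eq_zero.1 (eq_zero_of_integral_smooth_mul_eq_zero g
      (h := fun x => D.op g (fun _ => v) x - c * w x) (hDc.sub (hwc.const_mul c)) (fun η => ?_) x)
    have hη := η.contMDiff.continuous
    have hint : (fun x => η x * (D.op g (fun _ => v) x - c * w x)) =
        fun x => η x * D.op g (fun _ => v) x - c * (η x * w x) := by ext; ring
    rw [hint, integral_sub (f := fun x => η x * D.op g (fun _ => v) x)
      (g := fun x => c * (η x * w x)) (integrable_riemVolume_of_continuous g (hη.mul hDc))
      (integrable_riemVolume_of_continuous g ((hη.mul hwc).const_mul c)), integral_const_mul, h η,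
      sub_self]
  · rintro ⟨lam, h⟩
    have hDw : ∀ η : Smooth n M, ∫ x, η x * D.op g (fun _ => v) x ∂(riemVolume g) =
        (((n : ℝ) - 2 * k) / ((ℓ + 1 : ℕ) : ℝ)) ^ ℓ * lam * ∫ x, η x * w x ∂(riemVolume g) := by
      intro η
      rw [← integral_const_mul]
      refine integral_congr_ae (.of_forall fun x => ?_)
      simp only [h x, hw]
      ring
    have hvw : ∫ x, v x * w x ∂(riemVolume g) = Z := by
      refine integral_congr_ae (.of_forall fun x => ?_)
      rcases eq_or_ne (v x) 0 with hx | hx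
      -- At a zero of `v` both sides vanish; `0 ^ p = 0` needs `p ≠ 0`.
      · simp [hw, hx, Real.zero_rpow hp0]
      · have hsq : |v x| ^ p = |v x| ^ (p - 2) * |v x| ^ (2 : ℕ) := by
          rw [← Real.rpow_add_natCast (abs_ne_zero.mpr hx)]
          congr 1
          push_cast
          ring
        simp only [hw, hsq, sq_abs]
        ring
    -- Testing the equation with `v` itself identifies the multiplier.
    have hcl : c = (((n : ℝ) - 2 * k) / ((ℓ + 1 : ℕ) : ℝ)) ^ ℓ * lam := by
      rw [hc, div_eq_iff hZ.ne', ← hvw]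
      exact hDw v
    intro η
    rw [hDw η, hcl]
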